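/- Let $\mathcal V$ be a complete and cocomplete symmetric monoidal closed category, let $\mathcal A$ and $\mathcal B$ be $\mathcal V$-categories with $\mathcal A$ small ($\mathcal B$ need not be small), and let $F\colon \mathcal A\to\mathcal B$ be a $\mathcal V$-functor. For $b,b'\in\mathcal B$ write $$\varepsilon_{b,b'}\colon \int^{a\in\mathcal A}\mathcal B(Fa,b')\otimes\mathcal B(b,Fa)\longrightarrow \mathcal B(b,b')$$ for the morphism of $\mathcal V$ induced by the composition of $\mathcal B$, where $\int^a$ is the $\mathcal V$-enriched coend. Call $F$ *Cauchy dense* if $\varepsilon_{b,b'}$ is an isomorphism for all $b,b'\in\mathcal B$, and *split-full* if $F_{a,a'}\colon\mathcal A(a,a')\to\mathcal B(Fa,Fa')$ is a split epimorphism in $\mathcal V$ for all $a,a'\in\mathcal A$. **Theorem.** Suppose that $F$ is split-full. Then $F$ is Cauchy dense if and only if, for every $b\in\mathcal B$, the morphism $$\varepsilon_{b,b}\colon \int^{a\in\mathcal A}\mathcal B(Fa,b)\otimes\mathcal B(b,Fa)\longrightarrow \mathcal B(b,b)$$ is a split epimorphism in $\mathcal V$. -/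

import Mathlib

open CategoryTheory CategoryTheory.Limits CategoryTheory.MonoidalCategory

universe v u u₁ u₂

noncomputable section

namespace CategoryTheory.EnrichedFunctor

/-! Throughout, hom-objects are tensored in the diagrammatic order used for enriched categories in
Mathlib: `B(b, c) ⊗ B(c, d) ⟶ B(b, d)`. -/

variable {V : Type u} [Category.{v} V] [MonoidalCategory V]
  {A : Type u₁} [EnrichedCategory V A] {B : Type u₂} [EnrichedCategory V B]

/-- A `V`-functor `F : A → B` is split-full if each of its actions on hom-objects
`A(a, a') ⟶ B(F a, F a')` is a split epimorphism in `V`. -/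
def IsSplitFull (F : EnrichedFunctor V A B) : Prop :=
  ∀ a a' : A, IsSplitEpi (F.map a a')

/-- The covariant action `B(b, F a) ⊗ A(a, a') ⟶ B(b, F a')` of `A` on `B(b, F -)`. -/
def postAct (F : EnrichedFunctor V A B) (b : B) (a a' : A) :
    (b ⟶[V] F.obj a) ⊗ (a ⟶[V] a') ⟶ (b ⟶[V] F.obj a') :=
  (b ⟶[V] F.obj a) ◁ F.map a a' ≫ eComp V b (F.obj a) (F.obj a')

/-- The contravariant action `A(a, a') ⊗ B(F a', b') ⟶ B(F a, b')` of `A` on `B(F -, b')`. -/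
def preAct (F : EnrichedFunctor V A B) (a a' : A) (b' : B) :
    (a ⟶[V] a') ⊗ (F.obj a' ⟶[V] b') ⟶ (F.obj a ⟶[V] b') :=
  F.map a a' ▷ (F.obj a' ⟶[V] b') ≫ eComp V (F.obj a) (F.obj a') b'

variable (A) in
/-- The shape of the diagram defining a `V`-coend over `A`: one relation for each pair of objects
`(a, a')`, identifying something in the summand `a'` with something in the summand `a`. -/
@[simps]
abbrev coendShape : MultispanShape where
  L := A × A
  R := A
  fst p := p.2
  snd p := p.1

/-- The diagram whose colimit is the `V`-coend `∫^a B(b, F a) ⊗ B(F a, b')`: it has the two maps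
from `B(b, F a) ⊗ A(a, a') ⊗ B(F a', b')` to `B(b, F a') ⊗ B(F a', b')` and to
`B(b, F a) ⊗ B(F a, b')` given by the two actions of `A`. Its cocones are the cowedges. -/
@[simps]
def coendIndex (F : EnrichedFunctor V A B) (b b' : B) : MultispanIndex (coendShape A) V where
  left p := (b ⟶[V] F.obj p.1) ⊗ (p.1 ⟶[V] p.2) ⊗ (F.obj p.2 ⟶[V] b')
  right a := (b ⟶[V] F.obj a) ⊗ (F.obj a ⟶[V] b')
  fst p := (α_ _ _ _).inv ≫ F.postAct b p.1 p.2 ▷ (F.obj p.2 ⟶[V] b')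
  snd p := (b ⟶[V] F.obj p.1) ◁ F.preAct p.1 p.2 b'

/-- The `V`-coend `∫^a B(b, F a) ⊗ B(F a, b')`, the value at `(b, b')` of the composite of the
profunctors `B(-, F -)` and `B(F -, -)` induced by `F`. -/
def homCoend (F : EnrichedFunctor V A B) (b b' : B) [HasMulticoequalizer (F.coendIndex b b')] : V :=
  multicoequalizer (F.coendIndex b b')

/-- Composition in `B` is compatible with the two actions of `A`. -/
lemma postAct_eComp (F : EnrichedFunctor V A B) (b b' : B) (a a' : A) :
    ((α_ _ _ _).inv ≫ F.postAct b a a' ▷ (F.obj a' ⟶[V] b')) ≫ eComp V b (F.obj a') b' =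
      (b ⟶[V] F.obj a) ◁ F.preAct a a' b' ≫ eComp V b (F.obj a) b' := by
  simp only [postAct, preAct, comp_whiskerRight, MonoidalCategory.whiskerLeft_comp, Category.assoc]
  rw [← e_assoc]
  simp

/-- Composition in `B` is a cowedge. -/
lemma eComp_cowedge (F : EnrichedFunctor V A B) (b b' : B) (p : A × A) :
    (F.coendIndex b b').fst p ≫ eComp V b (F.obj p.2) b' =
      (F.coendIndex b b').snd p ≫ eComp V b (F.obj p.1) b' :=
  F.postAct_eComp b b' p.1 p.2

/-- The map `ε_{b, b'} : ∫^a B(b, F a) ⊗ B(F a, b') ⟶ B(b, b')` induced by composition in `B`,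
that is, the component at `(b, b')` of the counit of the adjunction between the two profunctors
induced by `F`. -/
def coendCounit (F : EnrichedFunctor V A B) (b b' : B)
    [HasMulticoequalizer (F.coendIndex b b')] : F.homCoend b b' ⟶ (b ⟶[V] b') :=
  Multicoequalizer.desc (F.coendIndex b b') (b ⟶[V] b')
    (fun a => eComp V b (F.obj a) b') (F.eComp_cowedge b b')

/-- A `V`-functor `F : A → B` is Cauchy dense if, for all `b` and `b'`, the coend
`∫^a B(b, F a) ⊗ B(F a, b')` exists and the map `ε_{b, b'}` from it to `B(b, b')` is an
isomorphism. (If `A` is small and `V` is cocomplete, then the coends always exist.) -/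
def IsCauchyDense (F : EnrichedFunctor V A B) : Prop :=
  ∀ b b' : B, ∃ _ : HasMulticoequalizer (F.coendIndex b b'), IsIso (F.coendCounit b b')

end CategoryTheory.EnrichedFunctor

end

noncomputable section

namespace CategoryTheory.EnrichedFunctor

variable {V : Type u} [Category.{v} V] [MonoidalCategory V]
  {A : Type u₁} [EnrichedCategory V A] {B : Type u₂} [EnrichedCategory V B]

/-! Write `H b b'` for the coend. Composition makes `H b -` a right `B`-module, and ε is a module
map. A section of `ε_{b,b}` lifts the identity of `b` to an element `s` of `H b b`; as in Yoneda, `σ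
f = s · f` is then a module map splitting every `ε_{b,b'}`. Split-fullness gives `ε_{b,Fa}` the left
inverse `g ↦ [g ⊗ 1]` (`coendCounit_comp_homCoendι_id`), so `σ g = [g ⊗ 1]` for `g : b ⟶ F a`.
Equivariance now yields `σ (ε [g ⊗ h]) = σ g · h = [g ⊗ h]`, so σ is a two-sided inverse
(`isIso_coendCounit`). -/

/-- Composition in the second factor is compatible with the two actions of `A`. -/
lemma preAct_whiskerRight_eComp (F : EnrichedFunctor V A B) (a a' : A) (b' b'' : B) :
    F.preAct a a' b' ▷ (b' ⟶[V] b'') ≫ eComp V (F.obj a) b' b'' =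
      (α_ _ _ _).hom ≫ (a ⟶[V] a') ◁ eComp V (F.obj a') b' b'' ≫ F.preAct a a' b'' := by
  simp only [preAct, whisker_exchange_assoc, comp_whiskerRight]
  simp [← e_assoc]

section Coend

variable (F : EnrichedFunctor V A B) (b b' : B) [HasMulticoequalizer (F.coendIndex b b')]

/-- The coprojection `B(b, F a) ⊗ B(F a, b') ⟶ ∫^a B(b, F a) ⊗ B(F a, b')`. -/
def homCoendι (a : A) : (b ⟶[V] F.obj a) ⊗ (F.obj a ⟶[V] b') ⟶ F.homCoend b b' :=
  Multicoequalizer.π (F.coendIndex b b') a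

/-- The coprojections form a cowedge. -/
lemma homCoendι_condition (a a' : A) :
    (α_ _ _ _).inv ≫ F.postAct b a a' ▷ (F.obj a' ⟶[V] b') ≫ F.homCoendι b b' a' =
      (b ⟶[V] F.obj a) ◁ F.preAct a a' b' ≫ F.homCoendι b b' a := by
  rw [← Category.assoc]
  exact Multicoequalizer.condition (F.coendIndex b b') (a, a')

@[simp]
lemma homCoendι_coendCounit (a : A) :
    F.homCoendι b b' a ≫ F.coendCounit b b' = eComp V b (F.obj a) b' :=
  Multicoequalizer.π_desc ..

/-- The morphism out of `∫^a B(b, F a) ⊗ B(F a, b')` induced by a cowedge. -/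
def homCoendDesc {X : V} (k : ∀ a, (b ⟶[V] F.obj a) ⊗ (F.obj a ⟶[V] b') ⟶ X)
    (hk : ∀ a a', (α_ _ _ _).inv ≫ F.postAct b a a' ▷ (F.obj a' ⟶[V] b') ≫ k a' =
      (b ⟶[V] F.obj a) ◁ F.preAct a a' b' ≫ k a) : F.homCoend b b' ⟶ X :=
  Multicoequalizer.desc (F.coendIndex b b') X k
    (fun p => (Category.assoc _ _ _).trans (hk p.1 p.2))

@[simp]
lemma homCoendι_homCoendDesc {X : V} (k : ∀ a, (b ⟶[V] F.obj a) ⊗ (F.obj a ⟶[V] b') ⟶ X)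
    (hk : ∀ a a', (α_ _ _ _).inv ≫ F.postAct b a a' ▷ (F.obj a' ⟶[V] b') ≫ k a' =
      (b ⟶[V] F.obj a) ◁ F.preAct a a' b' ≫ k a) (a : A) :
    F.homCoendι b b' a ≫ F.homCoendDesc b b' k hk = k a :=
  Multicoequalizer.π_desc ..

variable {F b b'} in
lemma homCoend_hom_ext {X : V} {f g : F.homCoend b b' ⟶ X}
    (h : ∀ a, F.homCoendι b b' a ≫ f = F.homCoendι b b' a ≫ g) : f = g :=
  Multicoequalizer.hom_ext _ _ _ h

/-- If `F` is split-full, every element of `∫^a' B(b, F a') ⊗ B(F a', F a)` is the class of its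
composite paired with the identity of `F a`. -/
lemma coendCounit_comp_homCoendι_id (hF : F.IsSplitFull) (a : A)
    [HasMulticoequalizer (F.coendIndex b (F.obj a))] :
    F.coendCounit b (F.obj a) ≫ (ρ_ _).inv ≫ (b ⟶[V] F.obj a) ◁ eId V (F.obj a) ≫
      F.homCoendι b (F.obj a) a = 𝟙 _ := by
  refine homCoend_hom_ext fun a' => ?_
  have := hF a' a
  have : IsSplitEpi ((b ⟶[V] F.obj a') ◁ F.map a' a) :=
    inferInstanceAs (IsSplitEpi ((tensorLeft _).map (F.map a' a)))
  -- Splitness survives tensoring, so the second factor may be assumed to come from `A(a', a)`.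
  rw [← cancel_epi ((b ⟶[V] F.obj a') ◁ F.map a' a), reassoc_of% homCoendι_coendCounit,
    Category.comp_id]
  have h := F.homCoendι_condition b (F.obj a) a' a
  -- The cowedge relation at the identity of `F a`: `[g ⊗ F k] = [g F k ⊗ 1]`.
  have h' := (b ⟶[V] F.obj a') ◁ ((ρ_ _).inv ≫ (a' ⟶[V] a) ◁ eId V (F.obj a)) ≫= h
  have e : ((ρ_ _).inv ≫ (a' ⟶[V] a) ◁ eId V (F.obj a)) ≫ F.preAct a' a (F.obj a) =
      F.map a' a := by
    simp only [preAct, Category.assoc, whisker_exchange_assoc]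
    simp
  rw [← MonoidalCategory.whiskerLeft_comp_assoc, e] at h'
  have e' : (b ⟶[V] F.obj a') ◁ ((ρ_ _).inv ≫ (a' ⟶[V] a) ◁ eId V (F.obj a)) ≫ (α_ _ _ _).inv =
      (ρ_ _).inv ≫ ((b ⟶[V] F.obj a') ⊗ (a' ⟶[V] a)) ◁ eId V (F.obj a) := by
    simp
  rw [← h', reassoc_of% e', whisker_exchange_assoc, ← rightUnitor_inv_naturality_assoc, postAct,
    Category.assoc]

end Coend

section Action

variable (F : EnrichedFunctor V A B)
  [∀ b b' : B, HasMulticoequalizer (F.coendIndex b b')] (b b' b'' b''' : B)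

/-- The component at `a` of the action of `B` on `∫^a B(b, F a) ⊗ B(F a, -)`. -/
def homCoendActAux (a : A) :
    ((b ⟶[V] F.obj a) ⊗ (F.obj a ⟶[V] b')) ⊗ (b' ⟶[V] b'') ⟶ F.homCoend b b'' :=
  (α_ _ _ _).hom ≫ (b ⟶[V] F.obj a) ◁ eComp V (F.obj a) b' b'' ≫ F.homCoendι b b'' a

/-- `B` acts on the far side of `B(F -, b')`, hence commutes with the action of `A`; this lets the
action descend to the coend. -/
lemma homCoendActAux_condition (a a' : A) :
    ((α_ _ _ _).inv ≫ F.postAct b a a' ▷ (F.obj a' ⟶[V] b')) ▷ (b' ⟶[V] b'') ≫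
        F.homCoendActAux b b' b'' a' =
      ((b ⟶[V] F.obj a) ◁ F.preAct a a' b') ▷ (b' ⟶[V] b'') ≫
        F.homCoendActAux b b' b'' a := by
  have h := ((α_ _ _ _).hom ≫ (b ⟶[V] F.obj a) ◁ ((α_ _ _ _).hom ≫
    (a ⟶[V] a') ◁ eComp V (F.obj a') b' b'')) ≫= F.homCoendι_condition b b'' a a'
  rw [Category.assoc, Category.assoc, ← MonoidalCategory.whiskerLeft_comp_assoc, Category.assoc,
    ← preAct_whiskerRight_eComp] at h
  simp only [homCoendActAux, comp_whiskerRight, whisker_assoc, Category.assoc,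
    Iso.inv_hom_id_assoc, MonoidalCategory.whiskerLeft_comp] at h ⊢
  rw [← h]
  simp only [associator_naturality_left_assoc, ← whisker_exchange_assoc]
  simp

variable [BraidedCategory V] [MonoidalClosed V]

variable {F b b'} in
-- By braiding and closedness `- ⊗ X` is a left adjoint, so the tensored coprojections stay jointly
-- epic.
lemma homCoend_whiskerRight_hom_ext {X Y : V} {f g : F.homCoend b b' ⊗ X ⟶ Y}
    (h : ∀ a, F.homCoendι b b' a ▷ X ≫ f = F.homCoendι b b' a ▷ X ≫ g) : f = g := by
  rw [← cancel_epi (β_ X (F.homCoend b b')).hom]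
  apply MonoidalClosed.curry_injective
  refine homCoend_hom_ext fun a => ?_
  rw [← MonoidalClosed.curry_natural_left, ← MonoidalClosed.curry_natural_left,
    BraidedCategory.braiding_naturality_right_assoc,
    BraidedCategory.braiding_naturality_right_assoc, h]

/-- The action of `B` on `∫^a B(b, F a) ⊗ B(F a, -)` by composition in the second factor. -/
def homCoendAct : F.homCoend b b' ⊗ (b' ⟶[V] b'') ⟶ F.homCoend b b'' :=
  (β_ _ _).inv ≫ MonoidalClosed.uncurry
    (F.homCoendDesc b b'
      (fun a => MonoidalClosed.curry ((β_ _ _).hom ≫ F.homCoendActAux b b' b'' a))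
      (fun a a' => by
        rw [← Category.assoc, ← MonoidalClosed.curry_natural_left,
          ← MonoidalClosed.curry_natural_left,
          BraidedCategory.braiding_naturality_right_assoc,
          BraidedCategory.braiding_naturality_right_assoc, homCoendActAux_condition]))

@[simp]
lemma homCoendι_whiskerRight_homCoendAct (a : A) :
    F.homCoendι b b' a ▷ (b' ⟶[V] b'') ≫ F.homCoendAct b b' b'' =
      (α_ _ _ _).hom ≫ (b ⟶[V] F.obj a) ◁ eComp V (F.obj a) b' b'' ≫ F.homCoendι b b'' a := by
  rw [homCoendAct, BraidedCategory.braiding_inv_naturality_left_assoc,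
    ← MonoidalClosed.uncurry_natural_left, homCoendι_homCoendDesc,
    MonoidalClosed.uncurry_curry, Iso.inv_hom_id_assoc, homCoendActAux]

/-- The counit is equivariant. -/
lemma homCoendAct_coendCounit :
    F.homCoendAct b b' b'' ≫ F.coendCounit b b'' =
      F.coendCounit b b' ▷ (b' ⟶[V] b'') ≫ eComp V b b' b'' := by
  refine homCoend_whiskerRight_hom_ext fun a => ?_
  rw [reassoc_of% homCoendι_whiskerRight_homCoendAct, homCoendι_coendCounit,
    ← comp_whiskerRight_assoc, homCoendι_coendCounit, ← e_assoc, Iso.hom_inv_id_assoc]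

/-- The action is associative. -/
lemma homCoendAct_assoc :
    F.homCoendAct b b' b'' ▷ (b'' ⟶[V] b''') ≫ F.homCoendAct b b'' b''' =
      (α_ _ _ _).hom ≫ F.homCoend b b' ◁ eComp V b' b'' b''' ≫ F.homCoendAct b b' b''' := by
  apply (cancel_epi (α_ _ _ _).inv).1
  refine homCoend_whiskerRight_hom_ext fun a => ?_
  rw [Iso.inv_hom_id_assoc, ← whisker_exchange_assoc, homCoendι_whiskerRight_homCoendAct,
    associator_inv_naturality_left_assoc, ← comp_whiskerRight_assoc,
    homCoendι_whiskerRight_homCoendAct]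
  simp only [comp_whiskerRight, whisker_assoc, Category.assoc,
    homCoendι_whiskerRight_homCoendAct, Iso.inv_hom_id_assoc]
  rw [associator_naturality_right_assoc,
    ← MonoidalCategory.whiskerLeft_comp_assoc _ _ (eComp V (F.obj a) b' b'''), ← e_assoc]
  simp [-e_assoc]

/-- The section of `ε_{b, b'}` obtained by acting on an element of `∫^a B(b, F a) ⊗ B(F a, b)`. -/
def homCoendSection (s : 𝟙_ V ⟶ F.homCoend b b) : (b ⟶[V] b') ⟶ F.homCoend b b' :=
  (λ_ _).inv ≫ s ▷ (b ⟶[V] b') ≫ F.homCoendAct b b b'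

variable {b} in
-- By equivariance, `ε (s · f) = ε s · f = 1 · f = f`.
lemma homCoendSection_coendCounit {s : 𝟙_ V ⟶ F.homCoend b b}
    (hs : s ≫ F.coendCounit b b = eId V b) :
    F.homCoendSection b b' s ≫ F.coendCounit b b' = 𝟙 _ := by
  simp only [homCoendSection, Category.assoc, homCoendAct_coendCounit]
  rw [← comp_whiskerRight_assoc, hs, e_id_comp]

/-- The section given by an element is equivariant. -/
lemma eComp_homCoendSection (s : 𝟙_ V ⟶ F.homCoend b b) :
    eComp V b b' b'' ≫ F.homCoendSection b b'' s =
      F.homCoendSection b b' s ▷ (b' ⟶[V] b'') ≫ F.homCoendAct b b' b'' := by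
  simp only [homCoendSection, comp_whiskerRight, Category.assoc, homCoendAct_assoc]
  rw [leftUnitor_inv_naturality_assoc, whisker_exchange_assoc, associator_naturality_left_assoc,
    leftUnitor_inv_whiskerRight_assoc, Iso.inv_hom_id_assoc]

variable {b} in
/-- If `F` is split-full and the identity of `b` lifts along `ε_{b, b}`, then all the `ε_{b, b'}`
are isomorphisms. -/
lemma isIso_coendCounit (hF : F.IsSplitFull) {s : 𝟙_ V ⟶ F.homCoend b b}
    (hs : s ≫ F.coendCounit b b = eId V b) : IsIso (F.coendCounit b b') := by
  refine ⟨F.homCoendSection b b' s, ?_, F.homCoendSection_coendCounit b' hs⟩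
  refine homCoend_hom_ext fun a => ?_
  -- A right inverse of `ε_{b,Fa}` equals its left inverse.
  have h : F.homCoendSection b (F.obj a) s =
      (ρ_ _).inv ≫ (b ⟶[V] F.obj a) ◁ eId V (F.obj a) ≫ F.homCoendι b (F.obj a) a := by
    have h := F.homCoendSection b (F.obj a) s ≫= F.coendCounit_comp_homCoendι_id b hF a
    rw [← Category.assoc, F.homCoendSection_coendCounit _ hs] at h
    simpa using h.symm
  rw [reassoc_of% homCoendι_coendCounit, eComp_homCoendSection, h]
  simp only [comp_whiskerRight, Category.assoc, homCoendι_whiskerRight_homCoendAct]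
  rw [associator_naturality_middle_assoc, ← MonoidalCategory.whiskerLeft_comp_assoc]
  rw [triangle_assoc_comp_right_inv_assoc, ← MonoidalCategory.whiskerLeft_comp_assoc]
  simp

end Action

end CategoryTheory.EnrichedFunctor

end

theorem theorem4p13 {V : Type u} [Category.{v} V] [MonoidalCategory V] [SymmetricCategory V]
    [MonoidalClosed V] [HasLimits V] [HasColimits V]
    {A : Type v} [EnrichedCategory V A] {B : Type u₂} [EnrichedCategory V B]
    (F : EnrichedFunctor V A B) (hF : F.IsSplitFull) :
    F.IsCauchyDense ↔ ∀ b : B, IsSplitEpi (F.coendCounit b b) := by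
  refine ⟨fun h b => ?_, fun h b b' => ⟨inferInstance, ?_⟩⟩
  · obtain ⟨_, _⟩ := h b b
    -- The two existence proofs for the coend agree by proof irrelevance.
    exact inferInstanceAs (IsSplitEpi (F.coendCounit b b))
  · have := h b
    -- The chosen section, applied to the identity of `b`, supplies `s`.
    exact F.isIso_coendCounit b' hF (s := eId V b ≫ section_ (F.coendCounit b b)) (by simp)
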